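/- A metric space $X$ is geodesic if any two points $p,q$ are joined by a geodesic, that is, a map $\sigma:[0,d(p,q)]\to X$ from $p$ to $q$ with $d(\sigma(s),\sigma(t))=|s-t|$. It is CAT($0$) if it is geodesic and the distance between any two points of any geodesic triangle is at most the distance between the corresponding points of the triangle with the same side lengths in the Euclidean plane (completeness is not assumed). In a CAT($0$) space geodesics between given endpoints are unique, and the angle between two nontrivial geodesics starting at a common point is the greatest lower bound of the corresponding angles in the Euclidean model triangles for initial subsegments of the two geodesics. The total rotation of a polygonal (piecewise geodesic) curve $\sigma$ with nondegenerate segments is $\tau_\sigma=\sum_i(\pi-\beta_i)$, where $\beta_i$ are the angles at its interior vertices. The total curvature of a curve on a compact interval $[a,b]$ is the limit superior, in $[0,\infty]$, of $\tau_\sigma$ over the polygonal curves $\sigma$ inscribed in it (with vertices at successive parameters of a subdivision of $[a,b]$) as the maximal segment length of $\sigma$ tends to $0$. **Theorem.** Let $X$ be a CAT($0$) space and let $\gamma:[0,\infty)\to X$ be a curve parametrized by arclength, i.e. the length of $\gamma|_{[s,t]}$ is $t-s$ for all $0\le s\le t$. For $t\ge 0$ let $\tau(t)\in[0,\infty]$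 be the total curvature of $\gamma|_{[0,t]}$, and let $c(t)$ be the smallest number such that $\gamma([0,t])$ lies in the closed ball of radius $c(t)$ about $\gamma(0)$. (a) If $\liminf_{t\to\infty}\tau(t)/t=0$, then $\gamma$ is unbounded. (b) If $a\in(0,1)$ and $\tau\in O(t^a)$ as $t\to\infty$ (there is a constant $A$ with $\tau(t)\le A t^a$ for all sufficiently large $t$), then $c\in\Omega(t^{1-a})$ as $t\to\infty$ (there is a constant $k>0$ with $c(t)\ge k\,t^{1-a}$ for all sufficiently large $t$). -/

import Mathlib

open Set Filter
open scoped ENNReal Topology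

noncomputable section

namespace CurveCAT0

variable {X : Type*} [MetricSpace X]

/-- `σ`, restricted to `[0, dist p q]`, is a (unit speed, minimizing) geodesic from `p` to `q`. -/
def IsGeodesic (σ : ℝ → X) (p q : X) : Prop :=
  σ 0 = p ∧ σ (dist p q) = q ∧
    ∀ s ∈ Icc 0 (dist p q), ∀ t ∈ Icc 0 (dist p q), dist (σ s) (σ t) = |s - t|

/-- `X` is a CAT(0) space: a geodesic metric space in which the distance between two points of a
geodesic triangle is at most the distance between the corresponding points of a model triangle
`p' q' r'` with the same side lengths in the Euclidean plane. For two points on one side this is an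
equality; for points on different sides, `p` names the common vertex of these sides (the third
side exists by `exists_geodesic`). -/
structure IsCAT0 (X : Type*) [MetricSpace X] : Prop where
  exists_geodesic : ∀ p q : X, ∃ σ : ℝ → X, IsGeodesic σ p q
  comparison : ∀ (p q r : X) (σ ρ : ℝ → X), IsGeodesic σ p q → IsGeodesic ρ p r →
    ∀ p' q' r' : EuclideanSpace ℝ (Fin 2),
      dist p' q' = dist p q → dist q' r' = dist q r → dist p' r' = dist p r →
    ∀ s ∈ Icc 0 (dist p q), ∀ t ∈ Icc 0 (dist p r),
    ∀ x' ∈ segment ℝ p' q', ∀ y' ∈ segment ℝ p' r', dist p' x' = s → dist p' y' = t →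
      dist (σ s) (ρ t) ≤ dist x' y'

/-- The angle at the vertex corresponding to `p` in the Euclidean model triangle with the side
lengths of `p x y` (law of cosines); meaningful for `x ≠ p` and `y ≠ p`. -/
def modelAngle (p x y : X) : ℝ :=
  Real.arccos ((dist p x ^ 2 + dist p y ^ 2 - dist x y ^ 2) / (2 * dist p x * dist p y))

/-- The angle at `p` between the geodesics from `p` to `x` and from `p` to `y`: the greatest lower
bound of the model angles of the triangles formed by nontrivial initial subsegments. In a CAT(0)
space the geodesics `σ` and `ρ` are unique. Meaningful for `x ≠ p` and `y ≠ p`. -/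
def angle (p x y : X) : ℝ :=
  sInf {θ : ℝ | ∃ σ ρ : ℝ → X, IsGeodesic σ p x ∧ IsGeodesic ρ p y ∧
    ∃ s ∈ Ioc 0 (dist p x), ∃ t ∈ Ioc 0 (dist p y), θ = modelAngle p (σ s) (ρ t)}

/-- The total rotation `∑ (π - βᵢ)` of the polygonal curve with successive vertices
`v 0, …, v n`, where `βᵢ` are the angles at the interior vertices `v 1, …, v (n - 1)`. -/
def totalRotation (n : ℕ) (v : ℕ → X) : ℝ :=
  ∑ i ∈ Finset.range (n - 1), (Real.pi - angle (v (i + 1)) (v i) (v (i + 2)))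

/-- The points `u 0 < ⋯ < u n` subdivide `[a, b]`, and successive points of `γ` at these parameters
are distinct, so that they are the vertices of a polygonal curve inscribed in `γ|[a, b]` with
nondegenerate segments. -/
def IsInscribed (γ : ℝ → X) (a b : ℝ) (n : ℕ) (u : ℕ → ℝ) : Prop :=
  u 0 = a ∧ u n = b ∧ ∀ i < n, u i < u (i + 1) ∧ γ (u i) ≠ γ (u (i + 1))

/-- The total curvature of `γ|[a, b]`, in `[0, ∞]`: the limit superior of the total rotation of
inscribed polygonal curves as the maximal length of their segments tends to `0`. -/
def totalCurvature (γ : ℝ → X) (a b : ℝ) : ℝ≥0∞ :=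
  ⨅ (δ : ℝ) (_ : 0 < δ), ⨆ (n : ℕ) (u : ℕ → ℝ) (_ : IsInscribed γ a b n u)
    (_ : ∀ i < n, dist (γ (u i)) (γ (u (i + 1))) < δ),
      ENNReal.ofReal (totalRotation n (fun i => γ (u i)))

/-- The total curvature function of a curve `γ` on `[0, ∞)`. -/
def tau (γ : ℝ → X) (t : ℝ) : ℝ≥0∞ := totalCurvature γ 0 t

/-- The circumradius function: `circumradius γ t` is the smallest `r` such that `γ|[0, t]` lies in
the ball of radius `r` about `γ 0`. -/
def circumradius (γ : ℝ → X) (t : ℝ) : ℝ :=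
  sInf {r : ℝ | γ '' Icc 0 t ⊆ Metric.closedBall (γ 0) r}

end CurveCAT0

end

/-!
Let `v 0, …, v n` be the vertices of a polygon in the closed ball of radius `r` about `p`. By the
cosine inequality in CAT(0) spaces, an edge `x y` is at most `d(p, x) cos ∠ₓ(p, y) + d(p, y) cos
∠ᵧ(p, x)`. Summing over the edges, each interior vertex `y` contributes `d(p, y)` times the sum of
the cosines of two angles that add up to at least the angle `β` of the polygon at `y`, and such a
sum is at most `π - β`. Hence a polygon that starts at `p` has length at most `r (1 + total
rotation)`.

A continuous curve is approximated in length by inscribed polygons of arbitrarily small mesh, so its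
length is at most `r` times one plus its total curvature. For the curves of the theorem this reads
`t ≤ c(t) (1 + τ(t))`, and both growth statements follow from this inequality.
-/

namespace CurveCAT0

open Real

variable {X : Type*} [MetricSpace X]

section ModelAngle

variable {p x y z : X} {θ : ℝ}

theorem modelAngle_nonneg (p x y : X) : 0 ≤ modelAngle p x y := arccos_nonneg _

theorem modelAngle_le_pi (p x y : X) : modelAngle p x y ≤ π := arccos_le_pi _

theorem modelAngle_comm (p x y : X) : modelAngle p x y = modelAngle p y x := by
  simp only [modelAngle, dist_comm x y, add_comm (dist p x ^ 2), mul_right_comm]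

/-- If `x = p` or `y = p`, both sides vanish. -/
theorem two_mul_cos_modelAngle (p x y : X) :
    2 * dist p x * dist p y * cos (modelAngle p x y)
      = dist p x ^ 2 + dist p y ^ 2 - dist x y ^ 2 := by
  rcases eq_or_ne x p with rfl | hx
  · simp
  rcases eq_or_ne y p with rfl | hy
  · simp [dist_comm]
  have hpos : 0 < 2 * dist p x * dist p y :=
    mul_pos (mul_pos two_pos (dist_pos.2 hx.symm)) (dist_pos.2 hy.symm)
  have hxy : dist x y ≤ dist p x + dist p y := dist_triangle_left x y p
  have hx : dist p x ≤ dist p y + dist x y := dist_triangle_right p x y |>.trans_eq <| by ring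
  have hy : dist p y ≤ dist p x + dist x y := dist_triangle p x y
  rw [modelAngle, cos_arccos, mul_div_cancel₀ _ hpos.ne']
  · rw [le_div_iff₀ hpos]
    nlinarith [dist_nonneg (x := x) (y := y)]
  · rw [div_le_iff₀ hpos]
    nlinarith [mul_nonneg (sub_nonneg.2 hx) (sub_nonneg.2 hy)]

theorem modelAngle_le_of_dist_sq_le (hx : 0 < dist p x) (hy : 0 < dist p y) (hθ : θ ∈ Icc 0 π)
    (h : dist x y ^ 2 ≤ dist p x ^ 2 + dist p y ^ 2 - 2 * dist p x * dist p y * cos θ) :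
    modelAngle p x y ≤ θ := by
  refine (strictAntiOn_cos.le_iff_ge hθ ⟨modelAngle_nonneg p x y, modelAngle_le_pi p x y⟩).1 ?_
  refine le_of_mul_le_mul_left ?_ (mul_pos (mul_pos two_pos hx) hy)
  rw [two_mul_cos_modelAngle]
  linarith

theorem dist_sq_le_of_modelAngle_le (hπ : θ ≤ π) (h : modelAngle p x y ≤ θ) :
    dist x y ^ 2 ≤ dist p x ^ 2 + dist p y ^ 2 - 2 * dist p x * dist p y * cos θ := by
  have hcos : cos θ ≤ cos (modelAngle p x y) :=
    cos_le_cos_of_nonneg_of_le_pi (modelAngle_nonneg p x y) hπ h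
  have := mul_le_mul_of_nonneg_left hcos (by positivity : 0 ≤ 2 * dist p x * dist p y)
  linarith [two_mul_cos_modelAngle p x y]

/-- The witnesses come from the planar triangle with apex angle `A + B` and legs of length `1`:
the ray that splits the apex angle into `A` and `B` meets the base at distance `u` from the apex,
and cuts it into pieces of lengths `a` and `b` proportional to `sin A` and `sin B`. -/
theorem exists_split_isosceles {A B : ℝ} (hA : 0 < A) (hB : 0 < B) (hAB : A + B < π) :
    ∃ u ∈ Ioc (0 : ℝ) 1, ∃ a ≥ 0, ∃ b ≥ 0, a ^ 2 = 1 + u ^ 2 - 2 * u * cos A ∧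
      b ^ 2 = 1 + u ^ 2 - 2 * u * cos B ∧ (a + b) ^ 2 = 2 - 2 * cos (A + B) := by
  have hsinA : 0 < sin A := sin_pos_of_pos_of_lt_pi hA (by linarith)
  have hsinB : 0 < sin B := sin_pos_of_pos_of_lt_pi hB (by linarith)
  have hsinAB : 0 < sin (A + B) := sin_pos_of_pos_of_lt_pi (by linarith) hAB
  have hS : 0 < sin A + sin B := by positivity
  have hA1 := sin_sq_add_cos_sq A
  have hB1 := sin_sq_add_cos_sq B
  set base := √(2 - 2 * cos (A + B))
  have hbase : base ^ 2 = 2 - 2 * cos (A + B) := sq_sqrt (by linarith [cos_le_one (A + B)])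
  refine ⟨sin (A + B) / (sin A + sin B), ⟨by positivity, ?_⟩,
    sin A / (sin A + sin B) * base, by positivity,
    sin B / (sin A + sin B) * base, by positivity, ?_, ?_, ?_⟩
  · rw [div_le_one hS, sin_add]
    nlinarith [cos_le_one A, cos_le_one B]
  · rw [mul_pow, hbase, sin_add, cos_add]
    field_simp
    grind
  · rw [mul_pow, hbase, sin_add, cos_add]
    field_simp
    grind
  · rw [← add_mul, ← add_div, div_self hS.ne', one_mul, hbase]

/-- Since `u` depends only on `A` and `B`, this applies to arbitrarily small triangles at `p`. -/
theorem exists_modelAngle_le_add {A B : ℝ} (hA : 0 < A) (hB : 0 < B) (hAB : A + B < π) :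
    ∃ u ∈ Ioc (0 : ℝ) 1, ∀ p x y z : X, 0 < dist p x → dist p z = dist p x →
      dist p y = u * dist p x → modelAngle p x y ≤ A → modelAngle p y z ≤ B →
        modelAngle p x z ≤ A + B := by
  obtain ⟨u, hu, a, ha, b, hb, ha2, hb2, hab⟩ := exists_split_isosceles hA hB hAB
  refine ⟨u, hu, fun p x y z hx hz hy hxy hyz => ?_⟩
  have hdxy : dist x y ≤ dist p x * a := by
    refine le_of_sq_le_sq ?_ (by positivity)
    rw [mul_pow, ha2]
    have := dist_sq_le_of_modelAngle_le (by linarith) hxy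
    rw [hy] at this
    linarith
  have hdyz : dist y z ≤ dist p x * b := by
    refine le_of_sq_le_sq ?_ (by positivity)
    rw [mul_pow, hb2]
    have := dist_sq_le_of_modelAngle_le (by linarith) hyz
    rw [hy, hz] at this
    linarith
  refine modelAngle_le_of_dist_sq_le hx (hz ▸ hx) ⟨by positivity, hAB.le⟩ ?_
  calc dist x z ^ 2 ≤ (dist p x * (a + b)) ^ 2 := by
        gcongr
        linarith [dist_triangle x y z]
    _ = dist p x ^ 2 + dist p z ^ 2 - 2 * dist p x * dist p z * cos (A + B) := by
        rw [mul_pow, hab, hz]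
        ring

end ModelAngle

section Comparison

variable {p q x y z : X} {σ ρ : ℝ → X} {s t : ℝ}

theorem IsGeodesic.dist_left (h : IsGeodesic σ p q) (hs : s ∈ Icc 0 (dist p q)) :
    dist p (σ s) = s := by
  have := h.2.2 0 ⟨le_rfl, dist_nonneg⟩ s hs
  rwa [h.1, zero_sub, abs_neg, abs_of_nonneg hs.1] at this

theorem IsGeodesic.initial (h : IsGeodesic σ p q) (hs : s ∈ Icc 0 (dist p q)) :
    IsGeodesic σ p (σ s) := by
  have hd := h.dist_left hs
  refine ⟨h.1, by rw [hd], fun a ha b hb => ?_⟩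
  rw [hd] at ha hb
  exact h.2.2 a ⟨ha.1, ha.2.trans hs.2⟩ b ⟨hb.1, hb.2.trans hs.2⟩

theorem smul_mem_segment_zero_smul {V : Type*} [AddCommGroup V] [Module ℝ V] (v : V) {a b : ℝ}
    (ha : a ∈ Icc 0 b) : a • v ∈ segment ℝ 0 (b • v) := by
  have := mem_image_of_mem (LinearMap.toSpanSingleton ℝ V v).toAffineMap (Icc_subset_segment ha)
  rw [image_segment] at this
  simpa using this

theorem dist_smul_smul_sq {V : Type*} [NormedAddCommGroup V] [InnerProductSpace ℝ V] {v w : V}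
    (hv : ‖v‖ = 1) (hw : ‖w‖ = 1) (a b : ℝ) :
    dist (a • v) (b • w) ^ 2 = a ^ 2 + b ^ 2 - 2 * a * b * inner ℝ v w := by
  rw [dist_eq_norm, norm_sub_sq_real, norm_smul, norm_smul, hv, hw, real_inner_smul_left,
    real_inner_smul_right, mul_one, mul_one, norm_eq_abs, norm_eq_abs, sq_abs, sq_abs]
  ring

theorem exists_unit_vectors_inner_eq_cos (θ : ℝ) :
    ∃ v w : EuclideanSpace ℝ (Fin 2), ‖v‖ = 1 ∧ ‖w‖ = 1 ∧ inner ℝ v w = cos θ :=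
  ⟨!₂[1, 0], !₂[cos θ, sin θ], by simp [EuclideanSpace.norm_eq],
    by simp [EuclideanSpace.norm_eq], by simp [PiLp.inner_apply]⟩

theorem IsCAT0.dist_sq_le (hX : IsCAT0 X) (hσ : IsGeodesic σ p x) (hρ : IsGeodesic ρ p y)
    (hs : s ∈ Icc 0 (dist p x)) (ht : t ∈ Icc 0 (dist p y)) :
    dist (σ s) (ρ t) ^ 2 ≤ s ^ 2 + t ^ 2 - 2 * s * t * cos (modelAngle p x y) := by
  obtain ⟨v, w, hv, hw, hvw⟩ := exists_unit_vectors_inner_eq_cos (modelAngle p x y)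
  have hdist (a : ℝ) (ha : 0 ≤ a) (u : EuclideanSpace ℝ (Fin 2)) (hu : ‖u‖ = 1) :
      dist 0 (a • u) = a := by
    rw [dist_zero_left, norm_smul, hu, mul_one, norm_of_nonneg ha]
  have hxy : dist (dist p x • v) (dist p y • w) = dist x y := by
    rw [← sq_eq_sq₀ dist_nonneg dist_nonneg, dist_smul_smul_sq hv hw, hvw, two_mul_cos_modelAngle]
    ring
  rw [← hvw, ← dist_smul_smul_sq hv hw]
  gcongr
  exact hX.comparison p x y σ ρ hσ hρ 0 (dist p x • v) (dist p y • w) (hdist _ dist_nonneg v hv)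
    hxy (hdist _ dist_nonneg w hw) s hs t ht _ (smul_mem_segment_zero_smul v hs) _
    (smul_mem_segment_zero_smul w ht) (hdist s hs.1 v hv) (hdist t ht.1 w hw)

theorem IsCAT0.geodesic_unique (hX : IsCAT0 X) (hσ : IsGeodesic σ p q) (hρ : IsGeodesic ρ p q) :
    EqOn σ ρ (Icc 0 (dist p q)) := by
  intro s hs
  rcases eq_or_ne p q with rfl | hpq
  · obtain rfl : s = 0 := by simpa using hs
    rw [hσ.1, hρ.1]
  have hangle : cos (modelAngle p q q) = 1 := by
    have := dist_pos.2 hpq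
    refine mul_left_cancel₀ (by positivity : 2 * dist p q * dist p q ≠ 0) ?_
    rw [two_mul_cos_modelAngle, dist_self]
    ring
  have hle := hX.dist_sq_le hσ hρ hs hs
  rw [hangle] at hle
  have hsq : dist (σ s) (ρ s) ^ 2 = 0 := le_antisymm (hle.trans_eq (by ring)) (sq_nonneg _)
  exact dist_eq_zero.1 (pow_eq_zero_iff two_ne_zero |>.1 hsq)

theorem IsCAT0.modelAngle_le (hX : IsCAT0 X) (hσ : IsGeodesic σ p x) (hρ : IsGeodesic ρ p y)
    (hs : s ∈ Ioc 0 (dist p x)) (ht : t ∈ Ioc 0 (dist p y)) :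
    modelAngle p (σ s) (ρ t) ≤ modelAngle p x y := by
  have hds := hσ.dist_left (Ioc_subset_Icc_self hs)
  have hdt := hρ.dist_left (Ioc_subset_Icc_self ht)
  refine modelAngle_le_of_dist_sq_le (hds.symm ▸ hs.1) (hdt.symm ▸ ht.1)
    ⟨modelAngle_nonneg p x y, modelAngle_le_pi p x y⟩ ?_
  rw [hds, hdt]
  exact hX.dist_sq_le hσ hρ (Ioc_subset_Icc_self hs) (Ioc_subset_Icc_self ht)

end Comparison

section Angle

variable {p x y z : X} {σ ρ : ℝ → X} {θ : ℝ}

theorem angle_nonneg (p x y : X) : 0 ≤ angle p x y := by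
  refine Real.sInf_nonneg ?_
  rintro _ ⟨σ, ρ, -, -, s, -, t, -, rfl⟩
  exact modelAngle_nonneg _ _ _

theorem angle_comm (p x y : X) : angle p x y = angle p y x := by
  refine congrArg sInf (Set.ext fun θ => ⟨?_, ?_⟩) <;>
  · rintro ⟨σ, ρ, hσ, hρ, s, hs, t, ht, rfl⟩
    exact ⟨ρ, σ, hρ, hσ, t, ht, s, hs, modelAngle_comm _ _ _⟩

theorem angle_le_modelAngle_of_isGeodesic (hσ : IsGeodesic σ p x) (hρ : IsGeodesic ρ p y) {s t : ℝ}
    (hs : s ∈ Ioc 0 (dist p x)) (ht : t ∈ Ioc 0 (dist p y)) :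
    angle p x y ≤ modelAngle p (σ s) (ρ t) := by
  refine csInf_le ⟨0, ?_⟩ ⟨σ, ρ, hσ, hρ, s, hs, t, ht, rfl⟩
  rintro _ ⟨σ, ρ, -, -, s, -, t, -, rfl⟩
  exact modelAngle_nonneg _ _ _

/-- If `x = p` or `y = p`, the angle is `sInf ∅ = 0`. -/
theorem IsCAT0.angle_le_modelAngle (hX : IsCAT0 X) (p x y : X) :
    angle p x y ≤ modelAngle p x y := by
  rcases eq_or_ne x p with rfl | hx
  · simpa [angle] using modelAngle_nonneg x x y
  rcases eq_or_ne y p with rfl | hy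
  · simpa [angle] using modelAngle_nonneg y x y
  obtain ⟨σ, hσ⟩ := hX.exists_geodesic p x
  obtain ⟨ρ, hρ⟩ := hX.exists_geodesic p y
  have := angle_le_modelAngle_of_isGeodesic hσ hρ ⟨dist_pos.2 hx.symm, le_rfl⟩
    ⟨dist_pos.2 hy.symm, le_rfl⟩
  rwa [hσ.2.1, hρ.2.1] at this

theorem IsCAT0.angle_le_pi (hX : IsCAT0 X) (p x y : X) : angle p x y ≤ π :=
  (hX.angle_le_modelAngle p x y).trans (modelAngle_le_pi p x y)

theorem IsCAT0.sub_two_mul_cos_angle_le_dist_sq (hX : IsCAT0 X) (p x y : X) :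
    dist p x ^ 2 + dist p y ^ 2 - 2 * dist p x * dist p y * cos (angle p x y) ≤ dist x y ^ 2 := by
  have hcos : cos (modelAngle p x y) ≤ cos (angle p x y) :=
    cos_le_cos_of_nonneg_of_le_pi (angle_nonneg p x y) (modelAngle_le_pi p x y)
      (hX.angle_le_modelAngle p x y)
  have := mul_le_mul_of_nonneg_left hcos (by positivity : 0 ≤ 2 * dist p x * dist p y)
  linarith [two_mul_cos_modelAngle p x y]

theorem exists_modelAngle_lt (hx : x ≠ p) (hy : y ≠ p) (hσ : IsGeodesic σ p x)
    (hρ : IsGeodesic ρ p y) (hθ : angle p x y < θ) :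
    ∃ σ ρ : ℝ → X, IsGeodesic σ p x ∧ IsGeodesic ρ p y ∧
      ∃ s ∈ Ioc 0 (dist p x), ∃ t ∈ Ioc 0 (dist p y), modelAngle p (σ s) (ρ t) < θ := by
  contrapose! hθ
  refine le_csInf ⟨_, σ, ρ, hσ, hρ, _, ⟨dist_pos.2 hx.symm, le_rfl⟩, _,
    ⟨dist_pos.2 hy.symm, le_rfl⟩, rfl⟩ ?_
  rintro _ ⟨σ', ρ', hσ', hρ', s, hs, t, ht, rfl⟩
  exact hθ σ' ρ' hσ' hρ' s hs t ht

theorem IsCAT0.eventually_modelAngle_le (hX : IsCAT0 X) (hx : x ≠ p) (hy : y ≠ p)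
    (hσ : IsGeodesic σ p x) (hρ : IsGeodesic ρ p y) (hθ : angle p x y < θ) :
    ∀ᶠ r in 𝓝[>] (0 : ℝ), ∀ s ∈ Ioc 0 r, ∀ t ∈ Ioc 0 r, modelAngle p (σ s) (ρ t) ≤ θ := by
  obtain ⟨σ', ρ', hσ', hρ', s, hs, t, ht, hlt⟩ := exists_modelAngle_lt hx hy hσ hρ hθ
  filter_upwards [Ioc_mem_nhdsGT hs.1, Ioc_mem_nhdsGT ht.1] with r hrs hrt a ha b hb
  have has : a ∈ Ioc 0 s := ⟨ha.1, ha.2.trans hrs.2⟩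
  have hbt : b ∈ Ioc 0 t := ⟨hb.1, hb.2.trans hrt.2⟩
  rw [hX.geodesic_unique hσ hσ' ⟨ha.1.le, has.2.trans hs.2⟩,
    hX.geodesic_unique hρ hρ' ⟨hb.1.le, hbt.2.trans ht.2⟩]
  have hs := Ioc_subset_Icc_self hs
  have ht := Ioc_subset_Icc_self ht
  refine le_trans (hX.modelAngle_le (hσ'.initial hs) (hρ'.initial ht) ?_ ?_) hlt.le
  · rwa [hσ'.dist_left hs]
  · rwa [hρ'.dist_left ht]

theorem IsCAT0.angle_triangle (hX : IsCAT0 X) (hx : x ≠ p) (hy : y ≠ p) (hz : z ≠ p) :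
    angle p x z ≤ angle p x y + angle p y z := by
  refine le_add_of_forall_lt fun A hA B hB => ?_
  rcases le_or_gt π (A + B) with hπ | hAB
  · exact (hX.angle_le_pi p x z).trans hπ
  obtain ⟨σ, hσ⟩ := hX.exists_geodesic p x
  obtain ⟨η, hη⟩ := hX.exists_geodesic p y
  obtain ⟨ρ, hρ⟩ := hX.exists_geodesic p z
  obtain ⟨u, hu, hmodel⟩ := exists_modelAngle_le_add (X := X)
    ((angle_nonneg p x y).trans_lt hA) ((angle_nonneg p y z).trans_lt hB) hAB
  have hsmall {d : ℝ} (hd : 0 < d) : ∀ᶠ r in 𝓝[>] (0 : ℝ), r ∈ Ioc 0 d := Ioc_mem_nhdsGT hd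
  obtain ⟨r, hxy, hyz, hrx, hry, hrz⟩ := ((hX.eventually_modelAngle_le hx hy hσ hη hA).and <|
    (hX.eventually_modelAngle_le hy hz hη hρ hB).and <| (hsmall (dist_pos.2 hx.symm)).and <|
    (hsmall (dist_pos.2 hy.symm)).and (hsmall (dist_pos.2 hz.symm))).exists
  have hr : r ∈ Ioc 0 r := ⟨hrx.1, le_rfl⟩
  have hur : u * r ∈ Ioc 0 r := ⟨mul_pos hu.1 hr.1, mul_le_of_le_one_left hr.1.le hu.2⟩
  have hσr := hσ.dist_left (Ioc_subset_Icc_self hrx)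
  have hρr := hρ.dist_left (Ioc_subset_Icc_self hrz)
  have hηr := hη.dist_left ⟨hur.1.le, hur.2.trans hry.2⟩
  exact (angle_le_modelAngle_of_isGeodesic hσ hρ hrx hrz).trans <|
    hmodel p (σ r) (η (u * r)) (ρ r) (hσr.symm ▸ hr.1) (hρr.trans hσr.symm) (by rw [hηr, hσr])
      (hxy r hr _ hur) (hyz _ hur r hr)

end Angle

section TotalRotation

theorem cos_add_cos_le_pi_sub {α α' β : ℝ} (hα : α ∈ Icc 0 π) (hα' : α' ∈ Icc 0 π)
    (hβ : β ∈ Icc 0 π) (h : β ≤ α + α') : cos α + cos α' ≤ π - β := by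
  have hdiff : 0 ≤ cos ((α - α') / 2) :=
    cos_nonneg_of_neg_pi_div_two_le_of_le (by linarith [hα.1, hα'.2]) (by linarith [hα.2, hα'.1])
  have hsum : cos ((α + α') / 2) ≤ (π - β) / 2 :=
    calc cos ((α + α') / 2) ≤ cos (β / 2) := cos_le_cos_of_nonneg_of_le_pi
          (by linarith [hβ.1]) (by linarith [hα.2, hα'.2]) (by linarith)
      _ = sin ((π - β) / 2) := by rw [← sin_pi_div_two_sub, sub_div]
      _ ≤ (π - β) / 2 := sin_le (by linarith [hβ.2])
  calc cos α + cos α' = 2 * (cos ((α + α') / 2) * cos ((α - α') / 2)) := by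
        rw [cos_add_cos, mul_assoc]
    _ ≤ 2 * ((π - β) / 2 * 1) := by
        gcongr
        · linarith [hβ.2]
        · exact cos_le_one _
    _ = π - β := by ring

/-- The length of the polygonal curve with successive vertices `v 0, …, v n`. -/
def polygonLength (n : ℕ) (v : ℕ → X) : ℝ := ∑ i ∈ Finset.range n, dist (v i) (v (i + 1))

theorem polygonLength_succ (n : ℕ) (v : ℕ → X) :
    polygonLength (n + 1) v = polygonLength n v + dist (v n) (v (n + 1)) :=
  Finset.sum_range_succ _ _

theorem polygonLength_congr {n : ℕ} {v w : ℕ → X} (h : ∀ i ≤ n, v i = w i) :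
    polygonLength n v = polygonLength n w :=
  Finset.sum_congr rfl fun i hi => by
    rw [h i (Finset.mem_range.1 hi).le, h (i + 1) (Finset.mem_range.1 hi)]

theorem totalRotation_add_two (n : ℕ) (v : ℕ → X) :
    totalRotation (n + 2) v
      = totalRotation (n + 1) v + (π - angle (v (n + 1)) (v n) (v (n + 2))) :=
  Finset.sum_range_succ _ _

namespace IsCAT0

variable {p x y z : X}

theorem dist_le_mul_cos_angle_add (hX : IsCAT0 X) (p : X) (hxy : x ≠ y) :
    dist x y ≤ dist p x * cos (angle x p y) + dist p y * cos (angle y p x) := by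
  have hx := hX.sub_two_mul_cos_angle_le_dist_sq x p y
  have hy := hX.sub_two_mul_cos_angle_le_dist_sq y p x
  rw [dist_comm x p] at hx
  rw [dist_comm y p, dist_comm y x] at hy
  refine le_of_mul_le_mul_left ?_ (dist_pos.2 hxy)
  linarith

theorem mul_cos_angle_add_cos_angle_le (hX : IsCAT0 X) {r : ℝ} (hxy : x ≠ y) (hzy : z ≠ y)
    (hr : dist p y ≤ r) :
    dist p y * cos (angle y p x) + dist p y * cos (angle y p z) ≤ r * (π - angle y x z) := by
  have hβ : angle y x z ∈ Icc 0 π := ⟨angle_nonneg y x z, hX.angle_le_pi y x z⟩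
  refine le_trans ?_ (mul_le_mul_of_nonneg_right hr (sub_nonneg.2 hβ.2))
  rcases eq_or_ne p y with rfl | hp
  · simp
  rw [← mul_add]
  gcongr
  refine cos_add_cos_le_pi_sub ⟨angle_nonneg _ _ _, hX.angle_le_pi _ _ _⟩
    ⟨angle_nonneg _ _ _, hX.angle_le_pi _ _ _⟩ hβ ?_
  rw [angle_comm y p x]
  exact hX.angle_triangle hxy hp hzy

theorem polygonLength_succ_le (hX : IsCAT0 X) (p : X) {r : ℝ} (v : ℕ → X) (n : ℕ)
    (hne : ∀ i ≤ n, v i ≠ v (i + 1)) (hr : ∀ i ≤ n, dist p (v i) ≤ r) :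
    polygonLength (n + 1) v ≤ dist p (v 0) + r * totalRotation (n + 1) v
      + dist p (v (n + 1)) * cos (angle (v (n + 1)) p (v n)) := by
  induction n with
  | zero =>
    have hedge := hX.dist_le_mul_cos_angle_add p (hne 0 le_rfl)
    have hcos := mul_le_of_le_one_right (dist_nonneg (x := p) (y := v 0))
      (cos_le_one (angle (v 0) p (v 1)))
    simp only [polygonLength, totalRotation, zero_add, Finset.sum_range_one, Nat.sub_self,
      Finset.range_zero, Finset.sum_empty, mul_zero, add_zero] at hedge ⊢
    linarith
  | succ n ih =>
    have hprev := ih (fun i hi => hne i (by lia)) (fun i hi => hr i (by lia))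
    have hedge := hX.dist_le_mul_cos_angle_add p (hne (n + 1) le_rfl)
    have hvertex := hX.mul_cos_angle_add_cos_angle_le (hne n (by lia)) (hne (n + 1) le_rfl).symm
      (hr (n + 1) le_rfl)
    rw [polygonLength_succ, totalRotation_add_two]
    linarith

theorem polygonLength_le (hX : IsCAT0 X) {r : ℝ} (v : ℕ → X) (n : ℕ)
    (hne : ∀ i < n, v i ≠ v (i + 1)) (hr : ∀ i ≤ n, dist (v 0) (v i) ≤ r) :
    polygonLength n v ≤ r * (1 + totalRotation n v) := by
  cases n with
  | zero => simpa [polygonLength, totalRotation] using hr 0 le_rfl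
  | succ n =>
    have hlen := hX.polygonLength_succ_le (v 0) v n (fun i hi => hne i (by lia))
      (fun i hi => hr i (by lia))
    have hcos := mul_le_of_le_one_right (dist_nonneg (x := v 0) (y := v (n + 1)))
      (cos_le_one (angle (v (n + 1)) (v 0) (v n)))
    rw [dist_self] at hlen
    linarith [hr (n + 1) le_rfl]

end IsCAT0

end TotalRotation

section InscribedPolygons

variable {γ : ℝ → X} {a b c d δ : ℝ} {n : ℕ} {u : ℕ → ℝ}

theorem ofReal_polygonLength (n : ℕ) (v : ℕ → X) :
    ENNReal.ofReal (polygonLength n v) = ∑ i ∈ Finset.range n, edist (v i) (v (i + 1)) := by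
  simp only [polygonLength, ENNReal.ofReal_sum_of_nonneg fun _ _ => dist_nonneg, edist_dist]

theorem IsInscribed.mem_Icc {Y : Type*} {γ : ℝ → Y} (h : IsInscribed γ a b n u) {i : ℕ}
    (hi : i ≤ n) : u i ∈ Icc a b := by
  have hmono : MonotoneOn u (Iic n) :=
    monotoneOn_of_le_add_one ordConnected_Iic fun i _ _ hi => (h.2.2 i hi).1.le
  exact ⟨h.1 ▸ hmono (mem_Iic.2 n.zero_le) hi i.zero_le, h.2.1 ▸ hmono hi self_mem_Iic hi⟩

theorem IsInscribed.exists_snoc (h : IsInscribed γ a c n u)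
    (hmesh : ∀ i < n, dist (γ (u i)) (γ (u (i + 1))) < δ) (hcd : c < d) (hne : γ c ≠ γ d)
    (hδ : dist (γ c) (γ d) < δ) :
    ∃ w, IsInscribed γ a d (n + 1) w ∧ (∀ i < n + 1, dist (γ (w i)) (γ (w (i + 1))) < δ) ∧
      polygonLength (n + 1) (fun i => γ (w i))
        = polygonLength n (fun i => γ (u i)) + dist (γ c) (γ d) := by
  have hlast : Function.update u (n + 1) d (n + 1) = d := Function.update_self ..
  have hinit {i : ℕ} (hi : i ≤ n) : Function.update u (n + 1) d i = u i :=
    Function.update_of_ne (by lia) ..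
  refine ⟨Function.update u (n + 1) d, ⟨?_, hlast, ?_⟩, ?_, ?_⟩
  · rw [hinit n.zero_le, h.1]
  · intro i hi
    rcases Nat.lt_succ_iff_lt_or_eq.1 hi with hi | rfl
    · rw [hinit hi.le, hinit hi]
      exact h.2.2 i hi
    · rw [hinit le_rfl, hlast, h.2.1]
      exact ⟨hcd, hne⟩
  · intro i hi
    rcases Nat.lt_succ_iff_lt_or_eq.1 hi with hi | rfl
    · rw [hinit hi.le, hinit hi]
      exact hmesh i hi
    · rwa [hinit le_rfl, hlast, h.2.1]
  · rw [polygonLength_succ, hinit le_rfl, hlast, h.2.1]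
    congr 1
    exact polygonLength_congr fun i hi => by rw [hinit hi]

/-- Points of `γ` that repeat their predecessor are skipped, so `c` may lag behind `u n`. -/
theorem exists_isInscribed_le_of_monotone (hu : Monotone u)
    (hmesh : ∀ i < n, dist (γ (u i)) (γ (u (i + 1))) < δ) :
    ∃ m v, ∃ c ≤ u n, γ c = γ (u n) ∧ IsInscribed γ (u 0) c m v ∧
      (∀ i < m, dist (γ (v i)) (γ (v (i + 1))) < δ) ∧
      polygonLength m (fun i => γ (v i)) = polygonLength n (fun i => γ (u i)) := by
  induction n with
  | zero => exact ⟨0, u, u 0, le_rfl, rfl, ⟨rfl, rfl, by simp⟩, by simp, rfl⟩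
  | succ n ih =>
    obtain ⟨m, v, c, hc, hγc, hv, hvmesh, hlen⟩ := ih fun i hi => hmesh i (by lia)
    rw [polygonLength_succ, ← hlen, ← hγc]
    by_cases hne : γ c = γ (u (n + 1))
    · exact ⟨m, v, c, hc.trans (hu n.le_succ), hne, hv, hvmesh, by rw [hne, dist_self, add_zero]⟩
    have hlt : c < u (n + 1) := (hc.trans (hu n.le_succ)).lt_of_ne fun h => hne (h ▸ rfl)
    obtain ⟨w, hw, hwmesh, hwlen⟩ := hv.exists_snoc hvmesh hlt hne (hγc ▸ hmesh n n.lt_succ_self)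
    exact ⟨m + 1, w, u (n + 1), le_rfl, rfl, hw, hwmesh, hwlen⟩

theorem exists_isInscribed_of_monotone (hu : Monotone u)
    (hmesh : ∀ i < n, dist (γ (u i)) (γ (u (i + 1))) < δ)
    (hpos : 0 < polygonLength n fun i => γ (u i)) :
    ∃ m v, IsInscribed γ (u 0) (u n) m v ∧ (∀ i < m, dist (γ (v i)) (γ (v (i + 1))) < δ) ∧
      polygonLength m (fun i => γ (v i)) = polygonLength n (fun i => γ (u i)) := by
  obtain ⟨m, v, c, hc, hγc, hv, hvmesh, hlen⟩ := exists_isInscribed_le_of_monotone hu hmesh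
  cases m with
  | zero => exact absurd hlen hpos.ne
  | succ k =>
    have hlast := hv.2.2 k k.lt_succ_self
    have hlastδ := hvmesh k k.lt_succ_self
    rw [hv.2.1, hγc] at hlast hlastδ
    have hk : IsInscribed γ (u 0) (v k) k v := ⟨hv.1, rfl, fun i hi => hv.2.2 i (by lia)⟩
    obtain ⟨w, hw, hwmesh, hwlen⟩ := hk.exists_snoc (fun i hi => hvmesh i (by lia))
      (hlast.1.trans_le hc) hlast.2 hlastδ
    refine ⟨k + 1, w, hw, hwmesh, ?_⟩
    rw [hwlen, ← hlen, polygonLength_succ, hv.2.1, hγc]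

end InscribedPolygons

section Grid

variable {E : Type*} {f : ℝ → E}

theorem eventually_lt_sum_edist_grid [PseudoEMetricSpace E] (hf : ContinuousOn f (Icc 0 1))
    {L : ℝ≥0∞} (hL : L < eVariationOn f (Icc 0 1)) :
    ∀ᶠ N : ℕ in atTop, L < ∑ k ∈ Finset.range N, edist (f (k / N)) (f ((k + 1 : ℕ) / N)) := by
  have hfloor (N : ℕ) {x : ℝ} (hx : x ∈ Icc 0 1) : ⌊x * N⌋₊ ≤ N :=
    Nat.floor_le_of_le (mul_le_of_le_one_left N.cast_nonneg hx.2)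
  have hlim (x : ℝ) (hx : x ∈ Icc 0 1) :
      Tendsto (fun N : ℕ => f (⌊x * N⌋₊ / N)) atTop (𝓝 (f x)) := by
    refine (hf x hx).tendsto.comp (tendsto_nhdsWithin_iff.2 ⟨?_, .of_forall fun N => ?_⟩)
    · exact (tendsto_nat_floor_mul_div_atTop hx.1).comp tendsto_natCast_atTop_atTop
    · exact ⟨by positivity, div_le_one_of_le₀ (mod_cast hfloor N hx) N.cast_nonneg⟩
  filter_upwards [eVariationOn.lowerSemicontinuous_aux hlim hL] with N hN
  refine hN.trans_le ?_
  calc eVariationOn ((fun k : ℕ => f (k / N)) ∘ fun x : ℝ => ⌊x * N⌋₊) (Icc 0 1)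
      ≤ eVariationOn (fun k : ℕ => f (k / N)) (id '' Iic N) := by
        refine eVariationOn.comp_le_of_monotoneOn _ _ (fun x _ y _ hxy => ?_) fun x hx => ?_
        · gcongr
        · simpa using hfloor N hx
    _ = ∑ k ∈ Finset.range N, edist (f (k / N)) (f ((k + 1 : ℕ) / N)) :=
        eVariationOn.image_range_of_monotone _ monotone_id N

theorem eventually_dist_grid_lt [PseudoMetricSpace E] (hf : ContinuousOn f (Icc 0 1)) {δ : ℝ}
    (hδ : 0 < δ) :
    ∀ᶠ N : ℕ in atTop, ∀ k < N, dist (f (k / N)) (f ((k + 1 : ℕ) / N)) < δ := by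
  obtain ⟨ε, hε, hfε⟩ := Metric.uniformContinuousOn_iff.1
    (isCompact_Icc.uniformContinuousOn_of_continuous hf) δ hδ
  filter_upwards [tendsto_one_div_atTop_nhds_zero_nat.eventually_lt_const hε] with N hN k hk
  have hmem {j : ℕ} (hj : j ≤ N) : (j / N : ℝ) ∈ Icc 0 1 :=
    ⟨by positivity, div_le_one_of_le₀ (mod_cast hj) N.cast_nonneg⟩
  refine hfε _ (hmem hk.le) _ (hmem hk) ?_
  rwa [dist_comm, dist_eq, ← sub_div, Nat.cast_succ, add_sub_cancel_left,
    abs_of_nonneg (by positivity)]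

end Grid

section TotalCurvature

variable {γ : ℝ → X} {a b : ℝ}

theorem exists_isInscribed_lt_polygonLength (hab : a ≤ b) (hγ : ContinuousOn γ (Icc a b))
    {L : ℝ≥0∞} (hL : L < eVariationOn γ (Icc a b)) {δ : ℝ} (hδ : 0 < δ) :
    ∃ n u, IsInscribed γ a b n u ∧ (∀ i < n, dist (γ (u i)) (γ (u (i + 1))) < δ) ∧
      L < ENNReal.ofReal (polygonLength n fun i => γ (u i)) := by
  have hmono : Monotone (AffineMap.lineMap a b : ℝ → ℝ) := AffineMap.lineMap_mono hab
  have himage : AffineMap.lineMap a b '' Icc (0 : ℝ) 1 = Icc a b := by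
    rw [← segment_eq_image_lineMap, segment_eq_Icc hab]
  have hcont : ContinuousOn (γ ∘ AffineMap.lineMap a b) (Icc (0 : ℝ) 1) :=
    hγ.comp AffineMap.lineMap_continuous.continuousOn (himage ▸ mapsTo_image _ _)
  rw [← himage, ← eVariationOn.comp_eq_of_monotoneOn _ _ (hmono.monotoneOn _)] at hL
  obtain ⟨N, hN, hlen, hmesh⟩ := ((eventually_gt_atTop 0).and <|
    (eventually_lt_sum_edist_grid hcont hL).and (eventually_dist_grid_lt hcont hδ)).exists
  have hu : Monotone fun k : ℕ => AffineMap.lineMap a b (k / N : ℝ) := fun i j hij =>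
    hmono (by gcongr)
  replace hlen : L < ENNReal.ofReal
      (polygonLength N fun k => γ (AffineMap.lineMap a b (k / N : ℝ))) := by
    rwa [ofReal_polygonLength]
  obtain ⟨n, v, hv, hvmesh, hvlen⟩ := exists_isInscribed_of_monotone hu hmesh
    (ENNReal.ofReal_pos.1 (bot_le.trans_lt hlen))
  refine ⟨n, v, ?_, hvmesh, hvlen ▸ hlen⟩
  simpa [hN.ne'] using hv

theorem IsCAT0.eVariationOn_le (hX : IsCAT0 X) (hab : a ≤ b) (hγ : ContinuousOn γ (Icc a b))
    {r : ℝ} (hr : γ '' Icc a b ⊆ Metric.closedBall (γ a) r) :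
    eVariationOn γ (Icc a b) ≤ ENNReal.ofReal r * (1 + totalCurvature γ a b) := by
  have hball {s : ℝ} (hs : s ∈ Icc a b) : dist (γ a) (γ s) ≤ r :=
    Metric.mem_closedBall'.1 (hr (mem_image_of_mem γ hs))
  have hr0 : 0 ≤ r := dist_nonneg.trans (hball ⟨le_rfl, hab⟩)
  rw [totalCurvature, iInf_subtype', ENNReal.add_iInf,
    ENNReal.mul_iInf' (fun h => absurd h ENNReal.ofReal_ne_top) fun _ => ⟨1, one_pos⟩]
  refine le_iInf fun ⟨δ, hδ⟩ => le_of_forall_lt fun L hL => ?_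
  obtain ⟨n, u, hu, hmesh, hlen⟩ := exists_isInscribed_lt_polygonLength hab hγ hL hδ
  calc L < ENNReal.ofReal (polygonLength n fun i => γ (u i)) := hlen
    _ ≤ ENNReal.ofReal (r * (1 + totalRotation n fun i => γ (u i))) :=
        ENNReal.ofReal_le_ofReal <| hX.polygonLength_le _ n (fun i hi => (hu.2.2 i hi).2)
          fun i hi => hu.1 ▸ hball (hu.mem_Icc hi)
    _ ≤ ENNReal.ofReal r * (1 + ENNReal.ofReal (totalRotation n fun i => γ (u i))) := by
        rw [ENNReal.ofReal_mul hr0]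
        gcongr
        exact ENNReal.ofReal_add_le.trans_eq (by rw [ENNReal.ofReal_one])
    _ ≤ _ := by
        gcongr
        exact le_iSup₂_of_le n u (le_iSup₂_of_le hu hmesh le_rfl)

theorem subset_closedBall_circumradius {t : ℝ} (h : Bornology.IsBounded (γ '' Icc 0 t)) :
    γ '' Icc 0 t ⊆ Metric.closedBall (γ 0) (circumradius γ t) := by
  obtain ⟨R, hR⟩ := h.subset_closedBall (γ 0)
  exact fun x hx => le_csInf ⟨R, hR⟩ fun r hr => hr hx

theorem circumradius_le {t R : ℝ} (ht : 0 ≤ t) (h : γ '' Icc 0 t ⊆ Metric.closedBall (γ 0) R) :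
    circumradius γ t ≤ R :=
  csInf_le ⟨0, fun _ hr => dist_nonneg.trans (hr (mem_image_of_mem γ ⟨le_rfl, ht⟩))⟩ h

theorem IsCAT0.div_one_add_le_circumradius (hX : IsCAT0 X) {t T : ℝ} (ht : 0 ≤ t) (hT : 0 ≤ T)
    (hγ : ContinuousOn γ (Icc 0 t)) (hlength : ENNReal.ofReal t ≤ eVariationOn γ (Icc 0 t))
    (htau : tau γ t ≤ ENNReal.ofReal T) : t / (1 + T) ≤ circumradius γ t := by
  have hball := subset_closedBall_circumradius (isCompact_Icc.image_of_continuousOn hγ).isBounded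
  have hr0 : 0 ≤ circumradius γ t := dist_nonneg.trans (hball (mem_image_of_mem γ ⟨le_rfl, ht⟩))
  rw [div_le_iff₀ (by positivity), ← ENNReal.ofReal_le_ofReal_iff (by positivity)]
  calc ENNReal.ofReal t ≤ ENNReal.ofReal (circumradius γ t) * (1 + tau γ t) :=
        hlength.trans (hX.eVariationOn_le ht hγ hball)
    _ ≤ ENNReal.ofReal (circumradius γ t) * (ENNReal.ofReal 1 + ENNReal.ofReal T) := by
        rw [ENNReal.ofReal_one]
        gcongr
    _ = ENNReal.ofReal (circumradius γ t * (1 + T)) := by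
        rw [← ENNReal.ofReal_add zero_le_one hT, ENNReal.ofReal_mul hr0]

end TotalCurvature

section UnitSpeed

variable {E : Type*} [PseudoEMetricSpace E] {f : ℝ → E} {s : Set ℝ}

theorem lipschitzOnWith_one_of_hasUnitSpeedOn (h : HasUnitSpeedOn f s) : LipschitzOnWith 1 f s := by
  intro x hx y hy
  wlog hxy : x ≤ y generalizing x y
  · rw [edist_comm, edist_comm x]
    exact this hy hx (le_of_not_ge hxy)
  calc edist (f x) (f y) ≤ eVariationOn f (s ∩ Icc x y) :=
        eVariationOn.edist_le f ⟨hx, le_rfl, hxy⟩ ⟨hy, hxy, le_rfl⟩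
    _ = (1 : NNReal) * edist x y := by
        rw [h hx hy, edist_comm, edist_dist, dist_eq, abs_of_nonneg (sub_nonneg.2 hxy)]
        simp

theorem eVariationOn_Icc_of_hasUnitSpeedOn_Ici (h : HasUnitSpeedOn f (Ici 0)) {t : ℝ}
    (ht : 0 ≤ t) : eVariationOn f (Icc 0 t) = ENNReal.ofReal t := by
  have := h self_mem_Ici ht
  rwa [inter_eq_right.2 Icc_subset_Ici_self, NNReal.coe_one, one_mul, sub_zero] at this

end UnitSpeed

section Growth

variable {γ : ℝ → X}

theorem IsCAT0.not_isBounded_of_liminf_tau_div_eq_zero (hX : IsCAT0 X)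
    (hγ : ContinuousOn γ (Ici 0))
    (hlength : ∀ᶠ t : ℝ in atTop, ENNReal.ofReal t ≤ eVariationOn γ (Icc 0 t))
    (hliminf : liminf (fun t : ℝ => tau γ t / ENNReal.ofReal t) atTop = 0) :
    ¬ Bornology.IsBounded (γ '' Ici 0) := by
  intro hbdd
  obtain ⟨R, hR0, hR⟩ := hbdd.subset_closedBall_lt 0 (γ 0)
  have hfreq : ∃ᶠ t : ℝ in atTop, tau γ t / ENNReal.ofReal t < ENNReal.ofReal (1 / (2 * R)) :=
    frequently_lt_of_liminf_lt (by isBoundedDefault)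
      (hliminf ▸ ENNReal.ofReal_pos.2 (by positivity))
  obtain ⟨t, htau, hlen, ht⟩ :=
    (hfreq.and_eventually (hlength.and (eventually_gt_atTop (2 * R)))).exists
  have ht0 : 0 < t := by linarith
  have htau' : tau γ t ≤ ENNReal.ofReal (1 / (2 * R) * t) := by
    rw [ENNReal.ofReal_mul (by positivity)]
    exact (ENNReal.div_le_iff (ENNReal.ofReal_pos.2 ht0).ne' ENNReal.ofReal_ne_top).1 htau.le
  have hle : t / (1 + 1 / (2 * R) * t) ≤ R :=
    (hX.div_one_add_le_circumradius ht0.le (by positivity) (hγ.mono Icc_subset_Ici_self) hlen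
      htau').trans <| circumradius_le ht0.le ((image_mono Icc_subset_Ici_self).trans hR)
  rw [div_le_iff₀ (by positivity)] at hle
  field_simp at hle
  linarith

theorem one_div_mul_rpow_le_div_one_add {t a A : ℝ} (ht : 1 ≤ t) (ha : 0 ≤ a) (hA : 0 ≤ A) :
    1 / (1 + A) * t ^ (1 - a) ≤ t / (1 + A * t ^ a) := by
  have ht0 : 0 < t := by linarith
  have hta : 1 ≤ t ^ a := one_le_rpow ht ha
  calc 1 / (1 + A) * t ^ (1 - a) = t / ((1 + A) * t ^ a) := by
        rw [rpow_sub ht0, rpow_one, div_mul_div_comm, one_mul]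
    _ ≤ t / (1 + A * t ^ a) := by
        gcongr
        linarith

theorem IsCAT0.exists_eventually_mul_rpow_le_circumradius (hX : IsCAT0 X)
    (hγ : ContinuousOn γ (Ici 0))
    (hlength : ∀ᶠ t : ℝ in atTop, ENNReal.ofReal t ≤ eVariationOn γ (Icc 0 t))
    {a A : ℝ} (ha : 0 ≤ a) (htau : ∀ᶠ t : ℝ in atTop, tau γ t ≤ ENNReal.ofReal (A * t ^ a)) :
    ∃ k : ℝ, 0 < k ∧ ∀ᶠ t : ℝ in atTop, k * t ^ (1 - a) ≤ circumradius γ t := by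
  refine ⟨1 / (1 + |A|), by positivity, ?_⟩
  filter_upwards [hlength, htau, eventually_ge_atTop 1] with t hlen htau ht
  refine (one_div_mul_rpow_le_div_one_add ht ha (abs_nonneg A)).trans <|
    hX.div_one_add_le_circumradius (by positivity) (by positivity) (hγ.mono Icc_subset_Ici_self)
      hlen (htau.trans ?_)
  gcongr
  exact le_abs_self A

end Growth

end CurveCAT0

theorem mainTheorem2_general {X : Type*} [MetricSpace X] (hX : CurveCAT0.IsCAT0 X)
    (γ : ℝ → X) (hγ : ContinuousOn γ (Ici 0))
    (hlength : ∀ᶠ t : ℝ in atTop, ENNReal.ofReal t ≤ eVariationOn γ (Icc 0 t)) :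
    (liminf (fun t : ℝ => CurveCAT0.tau γ t / ENNReal.ofReal t) atTop = 0 →
      ¬ Bornology.IsBounded (γ '' Ici 0)) ∧
    (∀ a ≥ (0 : ℝ),
      (∃ A : ℝ, ∀ᶠ t : ℝ in atTop, CurveCAT0.tau γ t ≤ ENNReal.ofReal (A * t ^ a)) →
      ∃ k : ℝ, 0 < k ∧ ∀ᶠ t : ℝ in atTop, k * t ^ (1 - a) ≤ CurveCAT0.circumradius γ t) :=
  ⟨hX.not_isBounded_of_liminf_tau_div_eq_zero hγ hlength, fun _ ha ⟨_, hA⟩ =>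
    hX.exists_eventually_mul_rpow_le_circumradius hγ hlength ha hA⟩

theorem mainTheorem2 {X : Type*} [MetricSpace X] (hX : CurveCAT0.IsCAT0 X)
    (γ : ℝ → X) (hγ : HasUnitSpeedOn γ (Ici 0)) :
    (liminf (fun t : ℝ => CurveCAT0.tau γ t / ENNReal.ofReal t) atTop = 0 →
      ¬ Bornology.IsBounded (γ '' Ici 0)) ∧
    (∀ a ∈ Ioo (0 : ℝ) 1,
      (∃ A : ℝ, ∀ᶠ t : ℝ in atTop, CurveCAT0.tau γ t ≤ ENNReal.ofReal (A * t ^ a)) →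
      ∃ k : ℝ, 0 < k ∧ ∀ᶠ t : ℝ in atTop, k * t ^ (1 - a) ≤ CurveCAT0.circumradius γ t) := by
  have hcont := (CurveCAT0.lipschitzOnWith_one_of_hasUnitSpeedOn hγ).continuousOn
  have hlength : ∀ᶠ t : ℝ in atTop, ENNReal.ofReal t ≤ eVariationOn γ (Icc 0 t) :=
    (eventually_ge_atTop 0).mono fun t ht =>
      (CurveCAT0.eVariationOn_Icc_of_hasUnitSpeedOn_Ici hγ ht).ge
  exact (mainTheorem2_general hX γ hcont hlength).imp_right fun h a ha => h a ha.1.le
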